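/- Work in the base system $\mathsf{RCA}_0$ of second-order arithmetic (the basic axioms, $\Sigma^0_1$ induction and $\Delta^0_1$ comprehension). For a set $M\subseteq\mathbb N$ let $M^{<\mathbb N}$ be the set of (codes of) finite subsets of $M$. An \emph{e-matroid} is a pair $(M,e)$ of a set $M\subseteq\mathbb N$ and a function $e\colon\mathbb N\to M^{<\mathbb N}$ such that (1) $(\forall n)\,[e(n)\neq\emptyset]$; (2) $(\forall n)(\forall Y\in M^{<\mathbb N})\,[e(n)\subseteq Y\to(\exists m)\,e(m)=Y]$; (3) for all $X,Y\in M^{<\mathbb N}$, if $|X|<|Y|$ and $(\forall n)[e(n)\neq X\wedge e(n)\neq Y]$, then $(\exists y\in Y)(\forall n)\,[e(n)\neq X\cup\{y\}]$. A set $B\subseteq M$ is a \emph{basis} for $(M,e)$ if it is independent, that is, $(\forall n)[e(n)\not\subseteq B]$, and it spans $M$, that is, $(\forall x\in M)\,[x\notin B\to(\exists n)\,e(n)\subseteq B\cup\{x\}]$. \textbf{Theorem.} $\mathsf{RCA}_0$ proves that the following are equivalent (that is, in every model of $\mathsf{RCA}_0$, with standard or nonstandard first-order part, the first holds if and only if the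 second does): (i) $\mathsf{ACA}_0$; (ii) every e-matroid has a basis. -/

import Mathlib

/-! Second-order arithmetic, its (Henkin) models, the systems RCA₀ and ACA₀, and
enumerated matroids inside a model. -/

namespace SOA

/-- A structure for the language of second-order arithmetic. `N` is the range of the number
variables (possibly nonstandard), `sets`, a nonempty family of subsets of `N`, is the range of the
set variables. -/
class L2Structure (N : Type*) extends Zero N, One N, Add N, Mul N, LT N where
  sets : Set (Set N)
  sets_nonempty : sets.Nonempty

/-- Numerical terms; number variables are de Bruijn indices. -/
inductive NumTerm : Type
  | var (i : ℕ)
  | zero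
  | one
  | add (s t : NumTerm)
  | mul (s t : NumTerm)

/-- Arithmetical formulas: no set quantifiers, free set variables `X₀, X₁, …` allowed.
`all` and `ball` bind the number variable `0` of their body; `ball t φ` is the bounded quantifier
`(∀ x < t) φ`, whose bound `t` lies outside the scope of `x`.  The other connectives and
quantifiers are classical abbreviations. -/
inductive ArithFormula : Type
  | eq (s t : NumTerm)
  | lt (s t : NumTerm)
  | mem (t : NumTerm) (X : ℕ)
  | neg (φ : ArithFormula)
  | and (φ ψ : ArithFormula)
  | ball (t : NumTerm) (φ : ArithFormula)
  | all (φ : ArithFormula)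

/-- Bounded quantifier formulas: every number quantifier is bounded. -/
def ArithFormula.IsBounded : ArithFormula → Prop
  | .eq _ _ => True
  | .lt _ _ => True
  | .mem _ _ => True
  | .neg φ => φ.IsBounded
  | .and φ ψ => φ.IsBounded ∧ ψ.IsBounded
  | .ball _ φ => φ.IsBounded
  | .all _ => False

/-- The valuation with `x` at index `0`, and `v` shifted up by one. -/
def push {N : Type*} (x : N) (v : ℕ → N) : ℕ → N
  | 0 => x
  | i + 1 => v i

section Semantics

variable {N : Type*} [L2Structure N]

def NumTerm.eval (v : ℕ → N) : NumTerm → N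
  | .var i => v i
  | .zero => 0
  | .one => 1
  | .add s t => s.eval v + t.eval v
  | .mul s t => s.eval v * t.eval v

/-- Satisfaction under a valuation `v` of the number variables and `V` of the set variables. -/
def ArithFormula.Sat (V : ℕ → Set N) : ArithFormula → (ℕ → N) → Prop
  | .eq s t, v => s.eval v = t.eval v
  | .lt s t, v => s.eval v < t.eval v
  | .mem t i, v => t.eval v ∈ V i
  | .neg φ, v => ¬ φ.Sat V v
  | .and φ ψ, v => φ.Sat V v ∧ ψ.Sat V v
  | .ball t φ, v => ∀ x : N, x < t.eval v → φ.Sat V (push x v)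
  | .all φ, v => ∀ x : N, φ.Sat V (push x v)

end Semantics

section Systems

variable (N : Type*) [L2Structure N]

/-- The basic axioms. -/
structure BasicAxioms : Prop where
  succ_ne_zero : ∀ n : N, n + 1 ≠ 0
  succ_inj : ∀ m n : N, m + 1 = n + 1 → m = n
  add_zero : ∀ m : N, m + 0 = m
  add_succ : ∀ m n : N, m + (n + 1) = (m + n) + 1
  mul_zero : ∀ m : N, m * 0 = 0
  mul_succ : ∀ m n : N, m * (n + 1) = m * n + m
  not_lt_zero : ∀ m : N, ¬ m < 0
  lt_succ : ∀ m n : N, m < n + 1 ↔ (m < n ∨ m = n)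

/-- The `Σ⁰₁` induction scheme: induction on `n` for `∃ m, θ(m, n)` with `θ` a bounded quantifier
formula, number parameters `v` and set parameters `V`. -/
def Sigma01Induction : Prop :=
  ∀ (θ : ArithFormula) (v : ℕ → N) (V : ℕ → Set N), θ.IsBounded →
    (∀ i, V i ∈ L2Structure.sets) →
    (∃ m, θ.Sat V (push m (push 0 v))) →
    (∀ n, (∃ m, θ.Sat V (push m (push n v))) → ∃ m, θ.Sat V (push m (push (n + 1) v))) →
    ∀ n, ∃ m, θ.Sat V (push m (push n v))

/-- The `Δ⁰₁` comprehension scheme: if the `Σ⁰₁` formula `∃ m, θ(m, n)` and the `Π⁰₁` formula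
`∀ m, η(m, n)` agree for all `n`, they define a set. -/
def Delta01Comprehension : Prop :=
  ∀ (θ η : ArithFormula) (v : ℕ → N) (V : ℕ → Set N), θ.IsBounded → η.IsBounded →
    (∀ i, V i ∈ L2Structure.sets) →
    (∀ n, (∃ m, θ.Sat V (push m (push n v))) ↔ ∀ m, η.Sat V (push m (push n v))) →
    {n : N | ∃ m, θ.Sat V (push m (push n v))} ∈ L2Structure.sets

/-- The induction axiom for sets. -/
def SetInduction : Prop :=
  ∀ X : Set N, X ∈ L2Structure.sets → (0 : N) ∈ X → (∀ n ∈ X, n + 1 ∈ X) → ∀ n, n ∈ X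

/-- The arithmetical comprehension scheme. -/
def ArithComprehension : Prop :=
  ∀ (φ : ArithFormula) (v : ℕ → N) (V : ℕ → Set N), (∀ i, V i ∈ L2Structure.sets) →
    {n : N | φ.Sat V (push n v)} ∈ L2Structure.sets

/-- `N` is a model of RCA₀. -/
structure RCA0 : Prop where
  basic : BasicAxioms N
  induction : Sigma01Induction N
  comprehension : Delta01Comprehension N

/-- `N` is a model of ACA₀. -/
structure ACA0 : Prop where
  basic : BasicAxioms N
  induction : SetInduction N
  comprehension : ArithComprehension N

end Systems

section Coding

variable {N : Type*} [L2Structure N]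

/-- The usual code `(i + j)² + i` of an ordered pair of numbers in subsystems of second-order
arithmetic. -/
def pair (i j : N) : N := (i + j) * (i + j) + i

/-- The finite set coded by the number `c = (k, (m, n))`: all `i < k` such that
`m(i+1)+1` divides `n` (numbers not of this form code the empty set). -/
def finSet (c : N) : Set N :=
  {i | ∃ k m n : N, c = pair k (pair m n) ∧ i < k ∧ ∃ q, n = (m * (i + 1) + 1) * q}

/-- `c` is the code of a finite set: the least number coding that set. -/
def IsFinCode (c : N) : Prop := ∀ d : N, finSet d = finSet c → c < d ∨ c = d

/-- The set of (codes of) finite subsets of `M`. -/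
def FinSubsets (M : Set N) : Set N := {c | IsFinCode c ∧ finSet c ⊆ M}

/-- The finite set coded by `c` has exactly `a` elements: some finite set of pairs is a bijection
from `{i | i < a}` onto it. -/
def HasCard (c a : N) : Prop :=
  ∃ p : N, (∀ z ∈ finSet p, ∃ i j, z = pair i j ∧ i < a ∧ j ∈ finSet c) ∧
    (∀ i, i < a → ∃! j, pair i j ∈ finSet p) ∧
    (∀ j ∈ finSet c, ∃! i, pair i j ∈ finSet p)

/-- `|X| < |Y|` for the finite sets coded by `c` and `d`. -/
def CardLT (c d : N) : Prop := ∃ a b : N, HasCard c a ∧ HasCard d b ∧ a < b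

/-- The function `f` on the numbers of the model belongs to the model: the set of pairs
`(n, f n)` is one of its sets. -/
def IsInternalFun (f : N → N) : Prop := {z : N | ∃ n, z = pair n (f n)} ∈ L2Structure.sets

/-- `(M, e)` is an e-matroid (of the model): `e` maps numbers to finite subsets of the set `M`. -/
structure IsEMatroid (M : Set N) (e : N → N) : Prop where
  ground : M ∈ L2Structure.sets
  enum : IsInternalFun e
  maps : ∀ n, e n ∈ FinSubsets M
  empty_indep : ∀ n, finSet (e n) ≠ ∅
  superset : ∀ n, ∀ Y ∈ FinSubsets M, finSet (e n) ⊆ finSet Y → ∃ m, finSet (e m) = finSet Y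
  exchange : ∀ X ∈ FinSubsets M, ∀ Y ∈ FinSubsets M, CardLT X Y →
    (∀ n, finSet (e n) ≠ finSet X ∧ finSet (e n) ≠ finSet Y) →
    ∃ y ∈ finSet Y, ∀ n, finSet (e n) ≠ finSet X ∪ {y}

/-- `B` is independent: it includes no enumerated (finite dependent) set. -/
def Indep (e : N → N) (B : Set N) : Prop := ∀ n, ¬ finSet (e n) ⊆ B

/-- `B` spans: adjoining any further element of `M` produces a dependent set, that is, a set
including an enumerated one. -/
def Spans (M : Set N) (e : N → N) (B : Set N) : Prop :=
  ∀ x ∈ M, x ∉ B → ∃ n, finSet (e n) ⊆ B ∪ {x}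

/-- `B` is a basis of `(M, e)` belonging to the model. -/
structure IsBasis (M : Set N) (e : N → N) (B : Set N) : Prop where
  isSet : B ∈ L2Structure.sets
  subset : B ⊆ M
  indep : Indep e B
  spans : Spans M e B

end Coding

/-- The model `N` satisfies "every e-matroid has a basis". -/
def EveryEMatroidHasBasis (N : Type*) [L2Structure N] : Prop :=
  ∀ (M : Set N) (e : N → N), IsEMatroid M e → ∃ B : Set N, IsBasis M e B

end SOA

/-!
Let `N` be a model of `RCA₀`.

If `N` satisfies `ACA₀`, a basis is the greedy set `B`: going through the numbers in increasing
order, `y ∈ M` is put into `B` unless some enumerated set is included in `(B ∩ [0, y)) ∪ {y}`.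
Arithmetical comprehension makes the condition on `y` a relation of the model, so induction yields
codes of all initial segments of `B`, and then `B` itself (`exists_greedy`). The set `B` is
independent because the largest element of an enumerated subset would have been rejected, and it
spans because every rejection is witnessed (`exists_isBasis`).

Conversely let `S = {x | ∃ y, R x y}` be a nonempty `Σ⁰₁` class. Take all numbers as ground set and
enumerate the finite sets that include `{pair x 0, pair x 1}` for some `x ∈ S`: this is possible
inside the model because a witness `y` can be read off the argument of the enumeration
(`exists_enumeration`). If `X` and `Y` are independent and `X ∪ {y}` is dependent for all `y ∈ Y`,
then the partner of each `y ∈ Y` lies in `X`, so `|Y| ≤ |X|` by the pigeonhole principle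
(`not_cardLT_of_partner`), and the exchange axiom holds. For every basis `B`, the class `S`
consists of the `x` for which `pair x 0` and `pair x 1` are not both in `B`, so `S` belongs to the
model (`sigmaComprehension_of_bases`). Finally `Σ⁰₁` comprehension, applied to codes of tuples,
eliminates unbounded quantifiers one by one and gives arithmetical comprehension
(`SigmaComprehension.aca0`).

Since `N` may be nonstandard, arithmetic, coding of finite sets and the pigeonhole principle are
developed inside `N` by `Σ⁰₁` induction. Instances of induction and comprehension are found by type
class inference: `IsRec R` says that the relation `R` is defined by a bounded formula with
parameters, and the closure properties of these relations are instances.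
-/

namespace SOA

universe u

/-! ### Substitution -/

/-- Simultaneous substitution of `s i` for the number variable `i`. -/
def NumTerm.subst (s : ℕ → NumTerm) : NumTerm → NumTerm
  | .var i => s i
  | .zero => .zero
  | .one => .one
  | .add a b => .add (a.subst s) (b.subst s)
  | .mul a b => .mul (a.subst s) (b.subst s)

/-- The substitution `s` moved under one binder. -/
def NumTerm.lift (s : ℕ → NumTerm) : ℕ → NumTerm :=
  push (.var 0) fun i => (s i).subst fun j => .var (j + 1)

/-- Substitution of the terms `s i` for the number variables, together with the renaming `σ` of
the set variables. -/
def ArithFormula.subst (σ : ℕ → ℕ) : (ℕ → NumTerm) → ArithFormula → ArithFormula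
  | s, .eq a b => .eq (a.subst s) (b.subst s)
  | s, .lt a b => .lt (a.subst s) (b.subst s)
  | s, .mem a X => .mem (a.subst s) (σ X)
  | s, .neg φ => .neg (φ.subst σ s)
  | s, .and φ ψ => .and (φ.subst σ s) (ψ.subst σ s)
  | s, .ball a φ => .ball (a.subst s) (φ.subst σ (NumTerm.lift s))
  | s, .all φ => .all (φ.subst σ (NumTerm.lift s))

theorem ArithFormula.IsBounded.subst (σ : ℕ → ℕ) {φ : ArithFormula} (h : φ.IsBounded)
    (s : ℕ → NumTerm) : (φ.subst σ s).IsBounded := by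
  induction φ generalizing s with
  | eq | lt | mem => trivial
  | neg φ ih => exact ih h s
  | and φ ψ ih₁ ih₂ => exact ⟨ih₁ h.1 s, ih₂ h.2 s⟩
  | ball t φ ih => exact ih h _
  | all => exact h.elim

variable {N : Type u} [L2Structure N]

theorem NumTerm.eval_subst (s : ℕ → NumTerm) (t : NumTerm) (v : ℕ → N) :
    (t.subst s).eval v = t.eval fun i => (s i).eval v := by
  induction t with
  | var | zero | one => rfl
  | add a b iha ihb | mul a b iha ihb => simp only [subst, eval, iha, ihb]

theorem NumTerm.eval_lift (s : ℕ → NumTerm) (x : N) (v : ℕ → N) :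
    (fun i => (NumTerm.lift s i).eval (push x v)) = push x fun i => (s i).eval v := by
  funext i
  cases i with
  | zero => rfl
  | succ i => exact NumTerm.eval_subst _ _ _

theorem ArithFormula.sat_subst (σ : ℕ → ℕ) (s : ℕ → NumTerm) (φ : ArithFormula)
    (V : ℕ → Set N) (v : ℕ → N) :
    (φ.subst σ s).Sat V v ↔ φ.Sat (fun i => V (σ i)) fun i => (s i).eval v := by
  induction φ generalizing s v with
  | eq | lt | mem => simp only [subst, Sat, NumTerm.eval_subst]
  | neg φ ih => simp only [subst, Sat, ih]
  | and φ ψ ih₁ ih₂ => simp only [subst, Sat, ih₁, ih₂]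
  | ball t φ ih => simp only [subst, Sat, ih, NumTerm.eval_subst, NumTerm.eval_lift]
  | all φ ih => simp only [subst, Sat, ih, NumTerm.eval_lift]

/-! ### Relations definable by bounded formulas with parameters -/

variable (N) in
/-- The type of `k`-tuples of numbers, as left-nested pairs. The last component is the innermost
number variable. -/
def Cx : ℕ → Type u
  | 0 => PUnit
  | k + 1 => Cx k × N

variable (N) in
/-- The empty tuple. -/
def Cx.nil : Cx N 0 := PUnit.unit

/-- The tuple `γ` extended by the innermost component `x`. -/
def Cx.snoc {k : ℕ} (γ : Cx N k) (x : N) : Cx N (k + 1) := (γ, x)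

/-- The valuation that lists the tuple `γ`, last component first, and then the parameters `w`. -/
def val : {k : ℕ} → Cx N k → (ℕ → N) → ℕ → N
  | 0, _, w => w
  | _ + 1, γ, w => push γ.2 (val γ.1 w)

/-- The sequence with `f` on the even and `g` on the odd indices. -/
def interleave {α : Type*} (f g : ℕ → α) (i : ℕ) : α :=
  if i % 2 = 0 then f (i / 2) else g (i / 2)

theorem interleave_even {α : Type*} (f g : ℕ → α) (i : ℕ) : interleave f g (2 * i) = f i := by
  simp [interleave]

theorem interleave_odd {α : Type*} (f g : ℕ → α) (i : ℕ) :
    interleave f g (2 * i + 1) = g i := by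
  simp [interleave, Nat.add_mod, show (2 * i + 1) / 2 = i by omega]

/-- The renaming of parameters by `ρ` that fixes the first `k` variables. -/
def liftRen (ρ : ℕ → ℕ) : ℕ → ℕ → ℕ
  | 0 => ρ
  | k + 1 => push 0 fun i => liftRen ρ k i + 1

omit [L2Structure N] in
theorem val_liftRen (ρ : ℕ → ℕ) {k : ℕ} (γ : Cx N k) (w : ℕ → N) (i : ℕ) :
    val γ w (liftRen ρ k i) = val γ (fun j => w (ρ j)) i := by
  induction k generalizing i with
  | zero => rfl
  | succ k ih =>
    cases i with
    | zero => rfl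
    | succ i => exact ih γ.1 i

/-- `f` is given by a term with parameters. -/
class IsPoly {k : ℕ} (f : Cx N k → N) : Prop where
  out : ∃ (t : NumTerm) (w : ℕ → N), ∀ γ, f γ = t.eval (val γ w)

/-- All components of the tuple valued function `h` are given by terms; formulated as what
substitution in a formula with parameters `w` needs. -/
class IsPolyMap {j k : ℕ} (h : Cx N j → Cx N k) : Prop where
  out : ∀ w : ℕ → N, ∃ (s : ℕ → NumTerm) (w' : ℕ → N),
    ∀ γ i, (s i).eval (val γ w') = val (h γ) w i

/-- `R` is defined by a bounded formula with number parameters and with set parameters from the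
model. By comprehension these are exactly the relations that belong to a model of `RCA₀`. -/
class IsRec {k : ℕ} (R : Cx N k → Prop) : Prop where
  out : ∃ (θ : ArithFormula) (V : ℕ → Set N) (w : ℕ → N), θ.IsBounded ∧
    (∀ i, V i ∈ L2Structure.sets) ∧ ∀ γ, R γ ↔ θ.Sat V (val γ w)

/-- `X` is one of the sets of the model. -/
class IsSet (X : Set N) : Prop where
  out : X ∈ L2Structure.sets

theorem eval_subst_liftRen (ρ : ℕ → ℕ) (t : NumTerm) {k : ℕ} (γ : Cx N k) (w : ℕ → N) :
    (t.subst fun i => .var (liftRen ρ k i)).eval (val γ w) =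
      t.eval (val γ fun j => w (ρ j)) := by
  rw [NumTerm.eval_subst]
  exact congrArg (t.eval ·) (funext fun i => val_liftRen ρ γ w i)

theorem sat_subst_liftRen (ρ σ : ℕ → ℕ) (θ : ArithFormula) {k : ℕ} (V : ℕ → Set N)
    (γ : Cx N k) (w : ℕ → N) :
    (θ.subst σ fun i => .var (liftRen ρ k i)).Sat V (val γ w) ↔
      θ.Sat (fun i => V (σ i)) (val γ fun j => w (ρ j)) := by
  rw [ArithFormula.sat_subst]
  exact iff_of_eq (congrArg (θ.Sat _ ·) (funext fun i => val_liftRen ρ γ w i))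

section Closure

variable {k : ℕ}

theorem IsPoly.common {f g : Cx N k → N} (hf : IsPoly f) (hg : IsPoly g) :
    ∃ (s t : NumTerm) (w : ℕ → N), (∀ γ, f γ = s.eval (val γ w)) ∧
      ∀ γ, g γ = t.eval (val γ w) := by
  obtain ⟨⟨s, w₁, hs⟩⟩ := hf
  obtain ⟨⟨t, w₂, ht⟩⟩ := hg
  refine ⟨s.subst fun i => .var (liftRen (2 * ·) k i),
    t.subst fun i => .var (liftRen (2 * · + 1) k i), interleave w₁ w₂, fun γ => ?_, fun γ => ?_⟩
  · simp only [eval_subst_liftRen, interleave_even, hs]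
  · simp only [eval_subst_liftRen, interleave_odd, ht]

theorem IsRec.common {R S : Cx N k → Prop} (hR : IsRec R) (hS : IsRec S) :
    ∃ (θ η : ArithFormula) (V : ℕ → Set N) (w : ℕ → N), θ.IsBounded ∧ η.IsBounded ∧
      (∀ i, V i ∈ L2Structure.sets) ∧ (∀ γ, R γ ↔ θ.Sat V (val γ w)) ∧
      ∀ γ, S γ ↔ η.Sat V (val γ w) := by
  obtain ⟨⟨θ, V₁, w₁, bθ, hV₁, hθ⟩⟩ := hR
  obtain ⟨⟨η, V₂, w₂, bη, hV₂, hη⟩⟩ := hS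
  refine ⟨θ.subst (2 * ·) fun i => .var (liftRen (2 * ·) k i),
    η.subst (2 * · + 1) fun i => .var (liftRen (2 * · + 1) k i), interleave V₁ V₂,
    interleave w₁ w₂, bθ.subst _ _, bη.subst _ _, fun i => ?_, fun γ => ?_, fun γ => ?_⟩
  · unfold interleave; split <;> apply_assumption
  · simp only [sat_subst_liftRen, interleave_even, hθ]
  · simp only [sat_subst_liftRen, interleave_odd, hη]

theorem IsPoly.common_isRec {f : Cx N k → N} {R : Cx N (k + 1) → Prop} (hf : IsPoly f)
    (hR : IsRec R) :
    ∃ (t : NumTerm) (θ : ArithFormula) (V : ℕ → Set N) (w : ℕ → N), θ.IsBounded ∧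
      (∀ i, V i ∈ L2Structure.sets) ∧ (∀ γ, f γ = t.eval (val γ w)) ∧
      ∀ γ, R γ ↔ θ.Sat V (val γ w) := by
  obtain ⟨⟨t, w₁, ht⟩⟩ := hf
  obtain ⟨⟨θ, V, w₂, bθ, hV, hθ⟩⟩ := hR
  refine ⟨t.subst fun i => .var (liftRen (2 * ·) k i),
    θ.subst id fun i => .var (liftRen (2 * · + 1) (k + 1) i), V,
    interleave w₁ w₂, bθ.subst _ _, hV, fun γ => ?_, fun γ => ?_⟩
  · simp only [eval_subst_liftRen, interleave_even, ht]
  · simp only [sat_subst_liftRen, interleave_odd, hθ, id]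

instance IsPoly.const (c : N) : IsPoly fun _ : Cx N k => c := by
  refine ⟨.var (liftRen id k k), fun _ => c, fun γ => ?_⟩
  rw [NumTerm.eval, val_liftRen]
  induction k with
  | zero => rfl
  | succ k ih => exact ih γ.1

instance IsPoly.add (f g : Cx N k → N) [hf : IsPoly f] [hg : IsPoly g] :
    IsPoly fun γ => f γ + g γ := by
  obtain ⟨s, t, w, hs, ht⟩ := hf.common hg
  exact ⟨.add s t, w, fun γ => by rw [hs, ht]; rfl⟩

instance IsPoly.mul (f g : Cx N k → N) [hf : IsPoly f] [hg : IsPoly g] :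
    IsPoly fun γ => f γ * g γ := by
  obtain ⟨s, t, w, hs, ht⟩ := hf.common hg
  exact ⟨.mul s t, w, fun γ => by rw [hs, ht]; rfl⟩

instance IsPoly.pair (f g : Cx N k → N) [IsPoly f] [IsPoly g] :
    IsPoly fun γ => pair (f γ) (g γ) := by
  unfold SOA.pair; infer_instance

instance IsPolyMap.fst : IsPolyMap fun γ : Cx N (k + 1) => γ.1 :=
  ⟨fun w => ⟨fun i => .var (i + 1), w, fun _ _ => rfl⟩⟩

theorem IsPolyMap.comp {i j : ℕ} (h : Cx N j → Cx N k) (g : Cx N i → Cx N j)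
    [hh : IsPolyMap h] [hg : IsPolyMap g] : IsPolyMap fun γ => h (g γ) := by
  refine ⟨fun w => ?_⟩
  obtain ⟨s, w', hs⟩ := hh.out w
  obtain ⟨s', w'', hs'⟩ := hg.out w'
  refine ⟨fun i => (s i).subst s', w'', fun γ i => ?_⟩
  rw [NumTerm.eval_subst, ← hs]
  exact congrArg ((s i).eval ·) (funext fun i => hs' γ i)

instance IsPolyMap.fst_fst : IsPolyMap fun γ : Cx N (k + 2) => γ.1.1 :=
  IsPolyMap.comp (fun γ : Cx N (k + 1) => γ.1) (fun γ : Cx N (k + 2) => γ.1)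

instance IsPolyMap.fst_fst_fst : IsPolyMap fun γ : Cx N (k + 3) => γ.1.1.1 :=
  IsPolyMap.comp (fun γ : Cx N (k + 1) => γ.1) (fun γ : Cx N (k + 3) => γ.1.1)

instance IsPolyMap.nil : IsPolyMap fun _ : Cx N k => Cx.nil N :=
  ⟨fun w => ⟨fun i => .var (i + k), w, fun γ i => by
    show val γ w (i + k) = w i
    induction k with
    | zero => rfl
    | succ k ih => exact ih γ.1⟩⟩

instance IsPolyMap.snoc {j : ℕ} (h : Cx N j → Cx N k) (f : Cx N j → N) [hh : IsPolyMap h]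
    [hf : IsPoly f] : IsPolyMap fun γ => (h γ).snoc (f γ) := by
  refine ⟨fun w => ?_⟩
  obtain ⟨s, w₁, hs⟩ := hh.out w
  obtain ⟨⟨t, w₂, ht⟩⟩ := hf
  refine ⟨push (t.subst fun i => .var (liftRen (2 * · + 1) j i))
    fun i => (s i).subst fun i => .var (liftRen (2 * ·) j i), interleave w₁ w₂, fun γ i => ?_⟩
  cases i with
  | zero => simp only [push, eval_subst_liftRen, interleave_odd, ← ht]; rfl
  | succ i => simp only [push, eval_subst_liftRen, interleave_even, hs]; rfl

theorem IsPoly.comp {j : ℕ} (f : Cx N k → N) (h : Cx N j → Cx N k) [hf : IsPoly f]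
    [hh : IsPolyMap h] : IsPoly fun γ => f (h γ) := by
  obtain ⟨⟨t, w, ht⟩⟩ := hf
  obtain ⟨s, w', hs⟩ := hh.out w
  refine ⟨t.subst s, w', fun γ => ?_⟩
  rw [NumTerm.eval_subst, ht]
  exact congrArg (t.eval ·) (funext fun i => (hs γ i).symm)

instance IsPoly.var0 : IsPoly fun γ : Cx N (k + 1) => γ.2 :=
  ⟨.var 0, fun _ => 0, fun _ => rfl⟩

instance IsPoly.var1 : IsPoly fun γ : Cx N (k + 2) => γ.1.2 :=
  ⟨.var 1, fun _ => 0, fun _ => rfl⟩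

instance IsPoly.var2 : IsPoly fun γ : Cx N (k + 3) => γ.1.1.2 :=
  ⟨.var 2, fun _ => 0, fun _ => rfl⟩

instance IsPoly.var3 : IsPoly fun γ : Cx N (k + 4) => γ.1.1.1.2 :=
  ⟨.var 3, fun _ => 0, fun _ => rfl⟩

instance IsPoly.var4 : IsPoly fun γ : Cx N (k + 5) => γ.1.1.1.1.2 :=
  ⟨.var 4, fun _ => 0, fun _ => rfl⟩

instance IsPoly.var5 : IsPoly fun γ : Cx N (k + 6) => γ.1.1.1.1.1.2 :=
  ⟨.var 5, fun _ => 0, fun _ => rfl⟩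

/-- Relations of the model are closed under substitution of polynomials. -/
theorem IsRec.comp {j : ℕ} (R : Cx N k → Prop) (h : Cx N j → Cx N k) [hR : IsRec R]
    [hh : IsPolyMap h] : IsRec fun γ => R (h γ) := by
  obtain ⟨⟨θ, V, w, bθ, hV, hθ⟩⟩ := hR
  obtain ⟨s, w', hs⟩ := hh.out w
  refine ⟨θ.subst _root_.id s, V, w', bθ.subst _ _, hV, fun γ => ?_⟩
  rw [ArithFormula.sat_subst, hθ]
  exact iff_of_eq (congrArg (θ.Sat V ·) (funext fun i => (hs γ i).symm))

theorem IsRec.of_iff {R S : Cx N k → Prop} (hS : IsRec S) (h : ∀ γ, R γ ↔ S γ) : IsRec R := by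
  obtain rfl : R = S := funext fun γ => propext (h γ)
  exact hS

instance IsRec.eq (f g : Cx N k → N) [hf : IsPoly f] [hg : IsPoly g] :
    IsRec fun γ => f γ = g γ := by
  obtain ⟨s, t, w, hs, ht⟩ := hf.common hg
  obtain ⟨X, hX⟩ := L2Structure.sets_nonempty (N := N)
  exact ⟨.eq s t, fun _ => X, w, trivial, fun _ => hX, fun γ => by rw [hs, ht]; rfl⟩

instance IsRec.lt (f g : Cx N k → N) [hf : IsPoly f] [hg : IsPoly g] :
    IsRec fun γ => f γ < g γ := by
  obtain ⟨s, t, w, hs, ht⟩ := hf.common hg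
  obtain ⟨X, hX⟩ := L2Structure.sets_nonempty (N := N)
  exact ⟨.lt s t, fun _ => X, w, trivial, fun _ => hX, fun γ => by rw [hs, ht]; rfl⟩

instance IsRec.mem (f : Cx N k → N) (X : Set N) [hf : IsPoly f] [hX : IsSet X] :
    IsRec fun γ => f γ ∈ X := by
  obtain ⟨⟨t, w, ht⟩⟩ := hf
  exact ⟨.mem t 0, fun _ => X, w, trivial, fun _ => hX.out, fun γ => by rw [ht]; rfl⟩

instance IsRec.not (R : Cx N k → Prop) [hR : IsRec R] : IsRec fun γ => ¬ R γ := by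
  obtain ⟨⟨θ, V, w, bθ, hV, hθ⟩⟩ := hR
  exact ⟨.neg θ, V, w, bθ, hV, fun γ => not_congr (hθ γ)⟩

instance IsRec.and (R S : Cx N k → Prop) [hR : IsRec R] [hS : IsRec S] :
    IsRec fun γ => R γ ∧ S γ := by
  obtain ⟨θ, η, V, w, bθ, bη, hV, hθ, hη⟩ := hR.common hS
  exact ⟨.and θ η, V, w, ⟨bθ, bη⟩, hV, fun γ => and_congr (hθ γ) (hη γ)⟩

instance IsRec.or (R S : Cx N k → Prop) [IsRec R] [IsRec S] : IsRec fun γ => R γ ∨ S γ :=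
  IsRec.of_iff (S := fun γ => ¬ (¬ R γ ∧ ¬ S γ)) inferInstance fun _ => by tauto

instance IsRec.imp (R S : Cx N k → Prop) [IsRec R] [IsRec S] : IsRec fun γ => R γ → S γ :=
  IsRec.of_iff (S := fun γ => ¬ R γ ∨ S γ) inferInstance fun _ => by tauto

instance IsRec.iff (R S : Cx N k → Prop) [IsRec R] [IsRec S] : IsRec fun γ => R γ ↔ S γ :=
  IsRec.of_iff (S := fun γ => (R γ → S γ) ∧ (S γ → R γ)) inferInstance fun _ => by tauto

instance IsRec.ball (f : Cx N k → N) (R : Cx N k → N → Prop) [hf : IsPoly f]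
    [hR : IsRec fun γ : Cx N (k + 1) => R γ.1 γ.2] : IsRec fun γ => ∀ x, x < f γ → R γ x := by
  obtain ⟨t, θ, V, w, bθ, hV, ht, hθ⟩ := hf.common_isRec hR
  refine ⟨.ball t θ, V, w, bθ, hV, fun γ => forall_congr' fun x => ?_⟩
  rw [ht]
  exact imp_congr_right fun _ => hθ (γ, x)

instance IsRec.bex (f : Cx N k → N) (R : Cx N k → N → Prop) [IsPoly f]
    [IsRec fun γ : Cx N (k + 1) => R γ.1 γ.2] : IsRec fun γ => ∃ x, x < f γ ∧ R γ x :=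
  IsRec.of_iff (S := fun γ => ¬ ∀ x, x < f γ → ¬ R γ x) inferInstance fun _ => by
    push Not; rfl

end Closure

/-! ### Induction and comprehension in models of `RCA₀` -/

variable [hN : Fact (RCA0 N)]

/-- `Σ⁰₁` induction, for `R` in the model. -/
theorem exists_induction (R : N → N → Prop) [hR : IsRec fun γ : Cx N 2 => R γ.1.2 γ.2]
    (h0 : ∃ m, R 0 m) (hs : ∀ n, (∃ m, R n m) → ∃ m, R (n + 1) m) (n : N) : ∃ m, R n m := by
  obtain ⟨⟨θ, V, w, bθ, hV, hθ⟩⟩ := hR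
  have h (n m : N) : R n m ↔ θ.Sat V (push m (push n w)) := hθ ((Cx.nil N, n), m)
  simp only [h] at *
  exact hN.out.induction θ w V bθ hV h0 hs n

theorem rec_induction (R : N → Prop) [hR : IsRec fun γ : Cx N 1 => R γ.2]
    (h0 : R 0) (hs : ∀ n, R n → R (n + 1)) (n : N) : R n := by
  have : IsRec fun γ : Cx N 2 => R γ.1.2 :=
    IsRec.comp (fun γ : Cx N 1 => R γ.2) fun γ : Cx N 2 => γ.1
  simpa using exists_induction (fun n _ => R n) ⟨0, h0⟩ (fun n ⟨m, h⟩ => ⟨m, hs n h⟩) n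

instance isSet_setOf (R : N → Prop) [hR : IsRec fun γ : Cx N 1 => R γ.2] : IsSet {n | R n} := by
  have : IsRec fun γ : Cx N 2 => R γ.1.2 :=
    IsRec.comp (fun γ : Cx N 1 => R γ.2) fun γ : Cx N 2 => γ.1
  obtain ⟨⟨θ, V, w, bθ, hV, hθ⟩⟩ := this
  have h (n m : N) : R n ↔ θ.Sat V (push m (push n w)) := hθ ((Cx.nil N, n), m)
  have := hN.out.comprehension θ θ w V bθ bθ hV fun n => by simp only [← h]; simp
  simp only [← h, exists_const] at this
  exact ⟨this⟩

/-! ### Arithmetic in models of `RCA₀` -/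

theorem basic : BasicAxioms N := hN.out.basic

theorem zero_add' (a : N) : 0 + a = a := by
  refine rec_induction (fun a : N => (0 : N) + a = a) (basic.add_zero 0) (fun n h => ?_) a
  rw [basic.add_succ, h]

theorem add_assoc' (a b c : N) : a + b + c = a + (b + c) := by
  refine rec_induction (fun c => a + b + c = a + (b + c)) ?_ (fun n h => ?_) c
  · simp only [basic.add_zero]
  · simp only [basic.add_succ, h]

theorem one_add' (a : N) : 1 + a = a + 1 := by
  refine rec_induction (fun a => 1 + a = a + 1) ?_ (fun n h => ?_) a
  · rw [basic.add_zero, zero_add']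
  · rw [basic.add_succ, h]

theorem add_comm' (a b : N) : a + b = b + a := by
  refine rec_induction (fun b => a + b = b + a) ?_ (fun n h => ?_) b
  · rw [basic.add_zero, zero_add']
  · rw [basic.add_succ, h, add_assoc', add_assoc', one_add']

theorem zero_mul' (a : N) : 0 * a = 0 := by
  refine rec_induction (fun a : N => (0 : N) * a = 0) (basic.mul_zero 0) (fun n h => ?_) a
  rw [basic.mul_succ, h, basic.add_zero]

theorem mul_add' (a b c : N) : a * (b + c) = a * b + a * c := by
  refine rec_induction (fun c => a * (b + c) = a * b + a * c) ?_ (fun n h => ?_) c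
  · rw [basic.add_zero, basic.mul_zero, basic.add_zero]
  · rw [basic.add_succ, basic.mul_succ, basic.mul_succ, h, add_assoc']

theorem add_mul' (a b c : N) : (a + b) * c = a * c + b * c := by
  refine rec_induction (fun c => (a + b) * c = a * c + b * c) ?_ (fun n h => ?_) c
  · simp only [basic.add_zero, basic.mul_zero]
  · rw [basic.mul_succ, basic.mul_succ, basic.mul_succ, h, add_assoc', add_assoc',
      ← add_assoc' (b * n) a b, add_comm' (b * n) a, add_assoc' a]

theorem mul_one' (a : N) : a * 1 = a := by
  rw [← zero_add' (1 : N), basic.mul_succ, basic.mul_zero, zero_add']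

theorem mul_comm' (a b : N) : a * b = b * a := by
  refine rec_induction (fun b => a * b = b * a) ?_ (fun n h => ?_) b
  · rw [basic.mul_zero, zero_mul']
  · rw [basic.mul_succ, add_mul', h, mul_comm_one]
where
  mul_comm_one {n : N} : n * a + a = n * a + 1 * a := by
    refine congrArg (n * a + ·) (rec_induction (fun a => a = 1 * a) ?_ (fun n h => ?_) a)
    · rw [basic.mul_zero]
    · rw [basic.mul_succ, ← h]

theorem mul_assoc' (a b c : N) : a * b * c = a * (b * c) := by
  refine rec_induction (fun c => a * b * c = a * (b * c)) ?_ (fun n h => ?_) c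
  · simp only [basic.mul_zero]
  · simp only [basic.mul_succ, h, mul_add']

instance : CommSemiring N where
  add_assoc := add_assoc'
  zero_add := zero_add'
  add_zero := basic.add_zero
  add_comm := add_comm'
  nsmul := nsmulRec
  left_distrib := mul_add'
  right_distrib := add_mul'
  zero_mul := zero_mul'
  mul_zero := basic.mul_zero
  mul_assoc := mul_assoc'
  one_mul a := by rw [mul_comm', mul_one']
  mul_one := mul_one'
  mul_comm := mul_comm'
  npow := npowRec

theorem add_left_cancel' {a b c : N} (h : c + a = c + b) : a = b := by
  refine rec_induction (fun c => c + a = c + b → a = b) ?_ (fun n ih h => ?_) c h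
  · simp
  · refine ih (basic.succ_inj _ _ ?_)
    rwa [add_right_comm, add_right_comm n b]

theorem lt_iff_exists_add_one {m n : N} : m < n ↔ ∃ k, n = m + (k + 1) := by
  constructor
  · intro h
    suffices ∃ k, m < n → n = m + (k + 1) from this.imp fun k hk => hk h
    refine exists_induction (fun n k => m < n → n = m + (k + 1))
      ⟨0, fun h => (basic.not_lt_zero _ h).elim⟩ (fun n ⟨k, hk⟩ => ?_) n
    by_cases h : m < n
    · exact ⟨k + 1, fun _ => by rw [hk h]; ring⟩
    · refine ⟨0, fun h' => ?_⟩
      obtain h' | rfl := (basic.lt_succ _ _).1 h'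
      · exact (h h').elim
      · simp
  · rintro ⟨k, rfl⟩
    refine rec_induction (fun k => m < m + (k + 1)) ?_ (fun n h => ?_) k
    · simp [basic.lt_succ]
    · rw [← add_assoc]
      exact (basic.lt_succ _ _).2 (Or.inl h)

theorem lt_irrefl' (a : N) : ¬ a < a := by
  rw [lt_iff_exists_add_one]
  rintro ⟨k, hk⟩
  exact basic.succ_ne_zero k (add_left_cancel' (c := a) (by rw [← hk, add_zero]))

theorem lt_trans' {a b c : N} (hab : a < b) (hbc : b < c) : a < c := by
  rw [lt_iff_exists_add_one] at *
  obtain ⟨k, rfl⟩ := hab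
  obtain ⟨l, rfl⟩ := hbc
  exact ⟨k + 1 + l, by ring⟩

theorem lt_trichotomy' (a b : N) : a < b ∨ a = b ∨ b < a := by
  have h0 (c : N) : 0 = c ∨ 0 < c := by
    refine rec_induction (fun c : N => 0 = c ∨ 0 < c) (Or.inl rfl) (fun n _ => ?_) c
    exact Or.inr (lt_iff_exists_add_one.2 ⟨n, by ring⟩)
  refine rec_induction (fun b => a < b ∨ a = b ∨ b < a) ?_ (fun n h => ?_) b
  · exact Or.inr ((h0 a).imp_left Eq.symm)
  · obtain h | rfl | h := h
    · exact Or.inl ((basic.lt_succ _ _).2 (Or.inl h))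
    · exact Or.inl ((basic.lt_succ _ _).2 (Or.inr rfl))
    · obtain ⟨k, rfl⟩ := lt_iff_exists_add_one.1 h
      obtain rfl | hk := h0 k
      · simp
      · obtain ⟨l, rfl⟩ := lt_iff_exists_add_one.1 hk
        exact Or.inr (Or.inr (lt_iff_exists_add_one.2 ⟨l, by ring⟩))

noncomputable instance : LinearOrder N where
  le a b := a < b ∨ a = b
  le_refl a := Or.inr rfl
  le_trans a b c := by
    rintro (h | rfl) (h' | rfl)
    exacts [Or.inl (lt_trans' h h'), Or.inl h, Or.inl h', Or.inr rfl]
  lt_iff_le_not_ge a b := by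
    refine ⟨fun h => ⟨Or.inl h, ?_⟩, ?_⟩
    · rintro (h' | rfl)
      exacts [lt_irrefl' _ (lt_trans' h h'), lt_irrefl' _ h]
    · rintro ⟨h | rfl, h'⟩
      exacts [h, (h' (Or.inr rfl)).elim]
  le_antisymm a b := by
    rintro (h | rfl) (h' | h')
    exacts [(lt_irrefl' _ (lt_trans' h h')).elim, h'.symm, rfl, rfl]
  le_total a b := by
    obtain h | rfl | h := lt_trichotomy' a b
    exacts [Or.inl (Or.inl h), Or.inl (Or.inr rfl), Or.inr (Or.inl h)]
  toDecidableLE := Classical.decRel _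

theorem lt_add_one_iff' {a b : N} : a < b + 1 ↔ a ≤ b := basic.lt_succ a b

theorem le_iff_exists_add' {a b : N} : a ≤ b ↔ ∃ c, b = a + c := by
  rw [← lt_add_one_iff', lt_iff_exists_add_one]
  refine exists_congr fun c => ⟨fun h => basic.succ_inj _ _ ?_, fun h => ?_⟩
  · rw [h, add_assoc]
  · rw [h, add_assoc]

theorem lt_mul_left' {a b c : N} (hc : 0 < c) (h : a < b) : c * a < c * b := by
  obtain ⟨k, rfl⟩ := lt_iff_exists_add_one.1 hc
  obtain ⟨l, rfl⟩ := lt_iff_exists_add_one.1 h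
  exact lt_iff_exists_add_one.2 ⟨k * l + k + l, by ring⟩

instance : IsStrictOrderedRing N where
  add_le_add_left _ _ h c := by
    obtain ⟨d, rfl⟩ := le_iff_exists_add'.1 h
    exact le_iff_exists_add'.2 ⟨d, by ring⟩
  le_of_add_le_add_left a _ _ h := by
    obtain ⟨d, hd⟩ := le_iff_exists_add'.1 h
    exact le_iff_exists_add'.2 ⟨d, add_left_cancel' (c := a) (by rw [hd]; ring)⟩
  zero_le_one := le_iff_exists_add'.2 ⟨1, by simp⟩
  exists_pair_ne := ⟨0 + 1, 0, basic.succ_ne_zero 0⟩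
  mul_lt_mul_of_pos_left _ ha _ _ h := lt_mul_left' ha h
  mul_lt_mul_of_pos_right _ ha _ _ h := by
    simpa only [mul_comm] using lt_mul_left' ha h

instance : CanonicallyOrderedAdd N where
  exists_add_of_le h := le_iff_exists_add'.1 h
  le_self_add _ b := le_iff_exists_add'.2 ⟨b, rfl⟩
  le_add_self _ b := le_iff_exists_add'.2 ⟨b, add_comm _ _⟩

theorem add_one_le_iff' {a b : N} : a + 1 ≤ b ↔ a < b := by
  rw [← lt_add_one_iff', add_lt_add_iff_right]

theorem le_mul_self' (a : N) : a ≤ a * a := by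
  obtain rfl | h := eq_or_ne a 0
  · simp
  · exact le_mul_of_one_le_left' (by simpa using add_one_le_iff'.2 (pos_iff_ne_zero.2 h))
where
  le_mul_of_one_le_left' {a b : N} (h : 1 ≤ b) : a ≤ b * a := by
    simpa using mul_le_mul_left h a

theorem le_pair_left (i j : N) : i ≤ pair i j := le_add_self

theorem le_pair_right (i j : N) : j ≤ pair i j :=
  calc j ≤ i + j := le_add_self
    _ ≤ (i + j) * (i + j) := le_mul_self' _
    _ ≤ _ := le_self_add

theorem pair_lt_of_add_lt {i j k l : N} (h : i + j < k + l) : pair i j < pair k l := by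
  have h1 := add_one_le_iff'.2 h
  calc pair i j < pair i j + 1 := by rw [lt_add_one_iff']
    _ ≤ (i + j) * (i + j) + (i + j) + (i + j) + 1 := by
      unfold pair
      gcongr ?_ + 1
      rw [add_assoc]
      gcongr
      rw [add_assoc]
      exact le_self_add
    _ = (i + j + 1) * (i + j + 1) := by ring
    _ ≤ (k + l) * (k + l) := by gcongr
    _ ≤ pair k l := le_self_add

theorem pair_inj {i j k l : N} : pair i j = pair k l ↔ i = k ∧ j = l := by
  refine ⟨fun h => ?_, by rintro ⟨rfl, rfl⟩; rfl⟩
  have hs : i + j = k + l := by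
    obtain h' | h' | h' := lt_trichotomy (i + j) (k + l)
    · exact absurd h (pair_lt_of_add_lt h').ne
    · exact h'
    · exact absurd h (pair_lt_of_add_lt h').ne'
  have hi : i = k := by
    simp only [pair, hs] at h
    exact add_left_cancel h
  subst hi
  exact ⟨rfl, add_left_cancel hs⟩

/-! ### Further closure properties -/

section Closure

variable {k : ℕ}

instance IsRec.le (f g : Cx N k → N) [IsPoly f] [IsPoly g] : IsRec fun γ => f γ ≤ g γ :=
  IsRec.of_iff (S := fun γ => f γ < g γ + 1) inferInstance fun _ => lt_add_one_iff'.symm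

instance IsRec.ball_le (f : Cx N k → N) (R : Cx N k → N → Prop) [IsPoly f]
    [IsRec fun γ : Cx N (k + 1) => R γ.1 γ.2] : IsRec fun γ => ∀ x, x ≤ f γ → R γ x :=
  IsRec.of_iff (S := fun γ => ∀ x, x < f γ + 1 → R γ x) inferInstance fun _ => by
    simp only [lt_add_one_iff']

instance IsRec.bex_le (f : Cx N k → N) (R : Cx N k → N → Prop) [IsPoly f]
    [IsRec fun γ : Cx N (k + 1) => R γ.1 γ.2] : IsRec fun γ => ∃ x, x ≤ f γ ∧ R γ x :=
  IsRec.of_iff (S := fun γ => ∃ x, x < f γ + 1 ∧ R γ x) inferInstance fun _ => by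
    simp only [lt_add_one_iff']

omit hN in
theorem IsRec.comp₁ (P : N → Prop) (f : Cx N k → N) [IsRec fun γ : Cx N 1 => P γ.2]
    [IsPoly f] : IsRec fun γ => P (f γ) :=
  IsRec.comp (fun γ : Cx N 1 => P γ.2) fun γ => (Cx.nil N).snoc (f γ)

omit hN in
theorem IsRec.comp₂ (P : N → N → Prop) (f g : Cx N k → N)
    [IsRec fun γ : Cx N 2 => P γ.1.2 γ.2] [IsPoly f] [IsPoly g] :
    IsRec fun γ => P (f γ) (g γ) :=
  IsRec.comp (fun γ : Cx N 2 => P γ.1.2 γ.2) fun γ => ((Cx.nil N).snoc (f γ)).snoc (g γ)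

end Closure

/-! ### Least numbers and finite sets -/

/-- The least number principle for the sets of the model. -/
theorem exists_least {X : Set N} [IsSet X] {n : N} (hn : n ∈ X) :
    ∃ m ∈ X, ∀ k < m, k ∉ X := by
  by_contra! h
  refine rec_induction (fun n => ∀ k, k < n → ¬ k ∈ X) (fun k hk => ?_) (fun n ih k hk => ?_)
    (n + 1) n (lt_add_one_iff'.2 le_rfl) hn
  · exact absurd hk not_lt_zero
  · intro hX
    obtain ⟨l, hl, hl'⟩ := h k hX
    exact ih l (hl.trans_le (lt_add_one_iff'.1 hk)) hl'

theorem mem_finSet_iff_bounded {i c : N} : i ∈ finSet c ↔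
    ∃ k ≤ c, ∃ m ≤ c, ∃ n ≤ c, c = pair k (pair m n) ∧ i < k ∧
      ∃ q ≤ n, n = (m * (i + 1) + 1) * q := by
  constructor
  · rintro ⟨k, m, n, rfl, hik, q, hq⟩
    have hmn := le_pair_right k (pair m n)
    refine ⟨k, le_pair_left _ _, m, (le_pair_left _ _).trans hmn, n,
      (le_pair_right _ _).trans hmn, rfl, hik, q, ?_, hq⟩
    rw [hq, add_mul, one_mul]
    exact le_add_self
  · rintro ⟨k, -, m, -, n, -, hc, hik, q, -, hq⟩
    exact ⟨k, m, n, hc, hik, q, hq⟩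

instance IsRec.mem_finSet {k : ℕ} (f g : Cx N k → N) [IsPoly f] [IsPoly g] :
    IsRec fun γ => f γ ∈ finSet (g γ) := by
  have : IsRec fun γ : Cx N 2 => γ.1.2 ∈ finSet γ.2 := by
    simp only [mem_finSet_iff_bounded]
    infer_instance
  exact IsRec.comp₂ (fun i c => i ∈ finSet c) f g

theorem lt_of_mem_finSet {i c : N} (h : i ∈ finSet c) : i < c := by
  obtain ⟨k, m, n, rfl, hik, -⟩ := h
  exact hik.trans_le (le_pair_left _ _)

instance IsRec.dvd {k : ℕ} (f g : Cx N k → N) [IsPoly f] [IsPoly g] :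
    IsRec fun γ => f γ ∣ g γ := by
  have : IsRec fun γ : Cx N 2 => γ.1.2 ∣ γ.2 := by
    refine IsRec.of_iff (S := fun γ => ∃ q ≤ γ.2, γ.2 = γ.1.2 * q) inferInstance fun γ => ?_
    refine ⟨fun ⟨q, hq⟩ => ?_, fun ⟨q, _, hq⟩ => ⟨q, hq⟩⟩
    obtain h | h := eq_or_ne γ.1.2 0
    · exact ⟨0, zero_le, by rw [hq, h, zero_mul, zero_mul]⟩
    · refine ⟨q, ?_, hq⟩
      have := mul_le_mul_left (add_one_le_iff'.2 (pos_iff_ne_zero.2 h)) q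
      rw [hq]
      simpa using this
  exact IsRec.comp₂ (fun a b => a ∣ b) f g

theorem dvd_of_dvd_add {d a b : N} (hd : d ≠ 0) (ha : d ∣ a) (hab : d ∣ a + b) : d ∣ b := by
  obtain ⟨x, rfl⟩ := ha
  obtain ⟨y, hy⟩ := hab
  have hxy : x ≤ y := le_of_mul_le_mul_left (hy ▸ le_self_add) (pos_iff_ne_zero.2 hd)
  obtain ⟨z, rfl⟩ := le_iff_exists_add'.1 hxy
  exact ⟨z, add_left_cancel (a := d * x) (by rw [hy, mul_add])⟩

/-- There is a positive common multiple of all positive numbers up to `a`. -/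
theorem exists_common_multiple (a : N) : ∃ m : N, 0 < m ∧ ∀ j < a, j + 1 ∣ m := by
  refine exists_induction (fun a m : N => 0 < m ∧ ∀ j < a, j + 1 ∣ m)
    ⟨1, one_pos, fun j hj => absurd hj not_lt_zero⟩
    (fun a ⟨m, h0, hm⟩ => ⟨m * (a + 1), by positivity, fun j hj => ?_⟩) a
  obtain hj | rfl := (lt_add_one_iff'.1 hj).lt_or_eq
  · exact (hm j hj).mul_right _
  · exact dvd_mul_left _ _

/-- If the difference of `i` and `b` divides `m`, then `m (i + 1) + 1` and `m (b + 1) + 1` are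
coprime, so that the second can be cancelled modulo the first. -/
theorem dvd_of_dvd_mul_beta {m i b d n : N} (h : b = i + d ∨ i = b + d) (hd : d ∣ m)
    (hn : m * (i + 1) + 1 ∣ n * (m * (b + 1) + 1)) : m * (i + 1) + 1 ∣ n := by
  have h0 : m * (i + 1) + 1 ≠ 0 := basic.succ_ne_zero _
  have hnd : m * (i + 1) + 1 ∣ n * d := by
    obtain rfl | rfl := h
    · refine dvd_of_dvd_add h0 (hn.mul_left (i + 1)) ?_
      exact ⟨n * (i + d + 1), by ring⟩
    · refine dvd_of_dvd_add h0 (Dvd.intro_left (n * (b + 1)) rfl) ?_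
      convert hn.mul_left (b + d + 1) using 1
      ring
  have hnm : m * (i + 1) + 1 ∣ n * m := hnd.trans (mul_dvd_mul_left n hd)
  refine dvd_of_dvd_add h0 (hnm.mul_right (i + 1)) ?_
  exact ⟨n, by ring⟩

theorem le_of_eq_add_add_one {a b d : N} (h : b = a + (d + 1)) : d ≤ b := by
  rw [h, ← add_assoc, add_right_comm]
  exact le_add_self

/-- Bounded comprehension for coded finite sets. The element `i` is
recorded by the divisor `m (i + 1) + 1` of the product of all the divisors that belong to elements,
where `m` is a positive common multiple of the numbers up to `a`. -/
theorem exists_finSet (a : N) (X : Set N) [IsSet X] :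
    ∃ c, ∀ i, i ∈ finSet c ↔ i < a ∧ i ∈ X := by
  obtain ⟨m, hm0, hm⟩ := exists_common_multiple a
  obtain ⟨n, hn⟩ : ∃ n : N, ∀ i < a, (m * (i + 1) + 1 ∣ n ↔ i < a ∧ i ∈ X) := by
    refine exists_induction (fun b n : N => ∀ i < a, (m * (i + 1) + 1 ∣ n ↔ i < b ∧ i ∈ X))
      ⟨1, fun i _ => ?_⟩ (fun b ⟨n, hn⟩ => ?_) a
    · simp only [not_lt_zero, false_and, iff_false]
      rintro ⟨q, hq⟩
      have : m * (i + 1) + 1 ≤ 1 := by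
        obtain rfl | h := eq_or_ne q 0
        · simp at hq
        · exact (le_mul_of_one_le_right zero_le
            (by simpa using add_one_le_iff'.2 (pos_iff_ne_zero.2 h))).trans hq.ge
      rw [add_one_le_iff'] at this
      exact absurd this (by rw [← zero_add (1 : N), lt_add_one_iff', not_le]; positivity)
    · by_cases hb : b < a ∧ b ∈ X
      · refine ⟨n * (m * (b + 1) + 1), fun i hi => ?_⟩
        rw [lt_add_one_iff', le_iff_lt_or_eq]
        obtain rfl | hib := eq_or_ne i b
        · simp [hb.2]
        · have hc : m * (i + 1) + 1 ∣ n * (m * (b + 1) + 1) ↔ m * (i + 1) + 1 ∣ n := by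
            refine ⟨fun h => ?_, fun h => h.mul_right _⟩
            obtain hlt | hlt := hib.lt_or_gt
            · obtain ⟨d, rfl⟩ := lt_iff_exists_add_one.1 hlt
              exact dvd_of_dvd_mul_beta (Or.inl rfl)
                (hm d ((le_of_eq_add_add_one rfl).trans_lt hb.1)) h
            · obtain ⟨d, rfl⟩ := lt_iff_exists_add_one.1 hlt
              exact dvd_of_dvd_mul_beta (Or.inr rfl)
                (hm d ((le_of_eq_add_add_one rfl).trans_lt hi)) h
          rw [hc, hn i hi]
          simp [hib]
      · refine ⟨n, fun i hi => ?_⟩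
        rw [hn i hi, lt_add_one_iff', le_iff_lt_or_eq]
        refine ⟨fun h => ⟨Or.inl h.1, h.2⟩, ?_⟩
        rintro ⟨h | rfl, h'⟩
        · exact ⟨h, h'⟩
        · exact absurd ⟨hi, h'⟩ hb
  refine ⟨pair a (pair m n), fun i => ⟨?_, fun h => ⟨a, m, n, rfl, h.1, (hn i h.1).2 h⟩⟩⟩
  rintro ⟨k, m', n', h, hi, hdvd⟩
  obtain ⟨rfl, h'⟩ := pair_inj.1 h
  obtain ⟨rfl, rfl⟩ := pair_inj.1 h'
  exact (hn i hi).1 hdvd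

theorem exists_isFinCode (c : N) : ∃ d, IsFinCode d ∧ finSet d = finSet c := by
  have h : IsRec fun γ : Cx N 1 => finSet γ.2 = finSet c := by
    refine IsRec.of_iff (S := fun γ => (∀ i < γ.2, i ∈ finSet γ.2 → i ∈ finSet c) ∧
      ∀ i < c, i ∈ finSet c → i ∈ finSet γ.2) inferInstance fun γ => ?_
    refine ⟨fun h => by simp [h], fun h => Set.ext fun i => ?_⟩
    exact ⟨fun hi => h.1 i (lt_of_mem_finSet hi) hi, fun hi => h.2 i (lt_of_mem_finSet hi) hi⟩
  obtain ⟨d, hd, hmin⟩ := exists_least (X := {d | finSet d = finSet c}) (n := c) rfl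
  refine ⟨d, fun d' hd' => ?_, hd⟩
  exact le_iff_lt_or_eq.1 (not_lt.1 fun h => hmin d' h (hd'.trans hd))

instance IsRec.isFinCode {k : ℕ} (f : Cx N k → N) [IsPoly f] :
    IsRec fun γ => IsFinCode (f γ) := by
  have : IsRec fun γ : Cx N 1 => IsFinCode γ.2 := by
    refine IsRec.of_iff (S := fun γ => ∀ d < γ.2, ∃ i < γ.2,
      ¬ (i ∈ finSet d ↔ i ∈ finSet γ.2)) inferInstance fun γ => ⟨fun h d hd => ?_, fun h d hd => ?_⟩
    · by_contra! h'
      have heq : finSet d = finSet γ.2 := Set.ext fun i => by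
        by_cases hi : i < γ.2
        · exact h' i hi
        · exact iff_of_false (fun h => hi ((lt_of_mem_finSet h).trans hd))
            fun h => hi (lt_of_mem_finSet h)
      obtain h | h := h d heq
      · exact absurd hd h.not_gt
      · exact hd.ne h.symm
    · refine le_iff_lt_or_eq.1 (not_lt.1 fun hlt => ?_)
      obtain ⟨i, -, hi⟩ := h d hlt
      exact hi (by rw [hd])
  exact IsRec.comp₁ IsFinCode f

theorem strong_induction {X : Set N} [IsSet X] (h : ∀ n, (∀ k < n, k ∈ X) → n ∈ X) (n : N) :
    n ∈ X := by
  by_contra hn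
  obtain ⟨m, hm, hmin⟩ := exists_least (X := {n | ¬ n ∈ X}) hn
  exact hm (h m fun k hk => not_not.1 (hmin k hk))

/-! ### The pigeonhole principle -/

/-- The finite set coded by `c` includes the graph of a total injective relation between the
numbers below `b` and the numbers below `a`. -/
def CodesInjection (c b a : N) : Prop :=
  (∀ i < b, ∃ k < a, pair i k ∈ finSet c) ∧
    ∀ i < b, ∀ j < b, ∀ k < a, pair i k ∈ finSet c → pair j k ∈ finSet c → i = j

theorem CodesInjection.pred {c a : N} (h : CodesInjection c (a + 1 + 1) (a + 1)) :
    ∃ d, CodesInjection d (a + 1) a := by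
  -- What was related to the value `a` is now related to the values of the removed point `a + 1`.
  obtain ⟨d, hd⟩ : ∃ d, ∀ z, z ∈ finSet d ↔ z < pair (a + 1) a ∧
      z ∈ {z : N | ∃ i ≤ z, ∃ k ≤ z, z = pair i k ∧
        (pair i k ∈ finSet c ∨ pair i a ∈ finSet c ∧ pair (a + 1) k ∈ finSet c)} :=
    exists_finSet _ _
  have hd' {i k : N} (hi : i < a + 1) (hk : k < a) : pair i k ∈ finSet d ↔
      pair i k ∈ finSet c ∨ pair i a ∈ finSet c ∧ pair (a + 1) k ∈ finSet c := by
    rw [hd]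
    refine ⟨?_, fun h => ⟨pair_lt_of_add_lt (add_lt_add hi hk),
      i, le_pair_left _ _, k, le_pair_right _ _, rfl, h⟩⟩
    rintro ⟨-, i', -, k', -, hp, h⟩
    obtain ⟨rfl, rfl⟩ := pair_inj.1 hp
    exact h
  have hlt {i : N} (hi : i < a + 1) : i < a + 1 + 1 := hi.trans (lt_add_one_iff'.2 le_rfl)
  have ha : a + 1 < a + 1 + 1 := lt_add_one_iff'.2 le_rfl
  have ha' : a < a + 1 := lt_add_one_iff'.2 le_rfl
  refine ⟨d, fun i hi => ?_, fun i hi j hj k hk h₁ h₂ => ?_⟩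
  · obtain ⟨k, hk, hik⟩ := h.1 i (hlt hi)
    obtain hk | rfl := (lt_add_one_iff'.1 hk).lt_or_eq
    · exact ⟨k, hk, (hd' hi hk).2 (Or.inl hik)⟩
    · obtain ⟨l, hl, hkl⟩ := h.1 (k + 1) ha
      obtain hl | rfl := (lt_add_one_iff'.1 hl).lt_or_eq
      · exact ⟨l, hl, (hd' hi hl).2 (Or.inr ⟨hik, hkl⟩)⟩
      · exact absurd (h.2 _ (hlt hi) _ ha _ hl hik hkl) hi.ne
  · have hk' : k < a + 1 := hk.trans ha'
    rw [hd' hi hk] at h₁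
    rw [hd' hj hk] at h₂
    obtain h₁ | ⟨h₁, h₁'⟩ := h₁ <;> obtain h₂ | ⟨h₂, h₂'⟩ := h₂
    · exact h.2 i (hlt hi) j (hlt hj) k hk' h₁ h₂
    · exact absurd (h.2 i (hlt hi) _ ha k hk' h₁ h₂') hi.ne
    · exact absurd (h.2 j (hlt hj) _ ha k hk' h₂ h₁') hj.ne
    · exact h.2 i (hlt hi) j (hlt hj) a ha' h₁ h₂

theorem not_codesInjection_succ (c a : N) : ¬ CodesInjection c (a + 1) a := by
  intro h
  -- By `Σ⁰₁` induction on `d`, there is a counterexample with `a - d` in place of `a`. For `d = a`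
  -- it would relate the number `0` to a number below `0`.
  have hrec : IsRec fun γ : Cx N 2 =>
      ∀ b ≤ a, b + γ.1.2 = a → CodesInjection γ.2 (b + 1) b := by
    unfold CodesInjection; infer_instance
  suffices ∃ c, ∀ b ≤ a, b + a = a → CodesInjection c (b + 1) b by
    obtain ⟨d, hd⟩ := this
    obtain ⟨k, hk, -⟩ := (hd 0 zero_le (zero_add a)).1 0 (lt_add_one_iff'.2 le_rfl)
    exact absurd hk not_lt_zero
  refine exists_induction
    (fun d c : N => ∀ b ≤ a, b + d = a → CodesInjection c (b + 1) b)
    ⟨c, fun b _ hb => by rw [add_zero] at hb; rwa [hb]⟩ (fun d ⟨c, hc⟩ => ?_) a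
  · by_cases hb : ∃ b, b + (d + 1) = a
    · obtain ⟨b, rfl⟩ := hb
      have e : b + 1 + d = b + (d + 1) := by ring
      obtain ⟨c', hc'⟩ := (hc (b + 1) (by rw [← e]; exact le_self_add) e).pred
      exact ⟨c', fun b' _ hb' => by rwa [add_right_cancel hb']⟩
    · exact ⟨0, fun b _ h => absurd ⟨b, h⟩ hb⟩

theorem le_of_injection {X : Set N} [IsSet X] {a b : N}
    (h₁ : ∀ i < b, ∃ k < a, pair i k ∈ X)
    (h₂ : ∀ i < b, ∀ j < b, ∀ k < a, pair i k ∈ X → pair j k ∈ X → i = j) : b ≤ a := by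
  by_contra! hab
  obtain ⟨c, hc⟩ := exists_finSet (pair b a) X
  have hab' := add_one_le_iff'.2 hab
  refine not_codesInjection_succ c a ⟨fun i hi => ?_, fun i hi j hj k hk hik hjk => ?_⟩
  · obtain ⟨k, hk, hik⟩ := h₁ i (hi.trans_le hab')
    exact ⟨k, hk, (hc _).2 ⟨pair_lt_of_add_lt (add_lt_add (hi.trans_le hab') hk), hik⟩⟩
  · exact h₂ i (hi.trans_le hab') j (hj.trans_le hab') k hk ((hc _).1 hik).2 ((hc _).1 hjk).2

/-! ### Arithmetical comprehension from `Σ⁰₁` comprehension -/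

variable (N) in
omit hN in
/-- `Σ⁰₁` comprehension. -/
def SigmaComprehension : Prop :=
  ∀ R : N → N → Prop, IsRec (fun γ : Cx N 2 => R γ.1.2 γ.2) → IsSet {n | ∃ m, R n m}

omit hN in
/-- The code of a tuple by iterated pairing. -/
def code : {k : ℕ} → Cx N k → N
  | 0, _ => 0
  | _ + 1, γ => pair (code γ.1) γ.2

theorem code_injective {k : ℕ} : Function.Injective (code : Cx N k → N) := by
  induction k with
  | zero => exact fun _ _ _ => rfl
  | succ k ih =>
    intro γ δ h
    obtain ⟨h₁, h₂⟩ := pair_inj.1 h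
    exact Prod.ext (ih h₁) h₂

omit hN in
theorem isPoly_code (k : ℕ) : IsPoly (code : Cx N k → N) := by
  induction k with
  | zero => exact IsPoly.const 0
  | succ k ih =>
    have : IsPoly fun γ : Cx N (k + 1) => code γ.1 := 
      IsPoly.comp code fun γ : Cx N (k + 1) => γ.1
    exact IsPoly.pair (fun γ : Cx N (k + 1) => code γ.1) fun γ => γ.2

theorem isRec_exists_code {k : ℕ} (R : Cx N (k + 1) → Prop) [hR : IsRec R] :
    IsRec fun p : Cx N 2 => ∃ γ : Cx N k, p.1.2 = code γ ∧ R (γ.snoc p.2) := by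
  induction k with
  | zero =>
    have : IsRec fun p : Cx N 2 => R ((Cx.nil N).snoc p.2) :=
      IsRec.comp R fun p : Cx N 2 => (Cx.nil N).snoc p.2
    refine IsRec.of_iff (S := fun p => p.1.2 = 0 ∧ R ((Cx.nil N).snoc p.2)) inferInstance
      fun p => ⟨fun ⟨_, h⟩ => h, fun h => ⟨Cx.nil N, h⟩⟩
  | succ k ih =>
    have h₄ : IsRec fun p : Cx N (k + 3) => R ((p.1.1.1.snoc p.1.2).snoc p.2) :=
      IsRec.comp R fun p : Cx N (k + 3) => (p.1.1.1.snoc p.1.2).snoc p.2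
    let R' (γ : Cx N (k + 1)) : Prop :=
      ∃ y ≤ γ.2, ∃ x ≤ γ.2, γ.2 = pair y x ∧ R ((γ.1.snoc y).snoc x)
    have hR' : IsRec R' := inferInstance
    have hI := ih R'
    have : IsRec fun p : Cx N 4 => ∃ γ : Cx N k, p.1.2 = code γ ∧
        R' (γ.snoc (pair p.2 p.1.1.2)) :=
      IsRec.comp₂ (fun u w => ∃ γ : Cx N k, u = code γ ∧ R' (γ.snoc w))
        (fun p : Cx N 4 => p.1.2) fun p => pair p.2 p.1.1.2
    refine IsRec.of_iff (S := fun p => ∃ u ≤ p.1.2, ∃ y ≤ p.1.2, p.1.2 = pair u y ∧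
      ∃ γ : Cx N k, u = code γ ∧ R' (γ.snoc (pair y p.2))) inferInstance fun p => ?_
    constructor
    · rintro ⟨γ, h, hγ⟩
      exact ⟨code γ.1, h ▸ le_pair_left _ _, γ.2, h ▸ le_pair_right _ _, h, γ.1, rfl,
        γ.2, le_pair_left _ _, p.2, le_pair_right _ _, rfl, hγ⟩
    · rintro ⟨u, -, y, -, h, γ, rfl, y', -, x', -, h', hR⟩
      obtain ⟨rfl, rfl⟩ := pair_inj.1 h'
      exact ⟨γ.snoc y, h, hR⟩

section

variable [hS : Fact (SigmaComprehension N)] {k : ℕ}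

/-- Under `Σ⁰₁` comprehension the relations of the model are closed under unbounded
quantification: the tuples with the property form a set of codes. -/
instance IsRec.ex (R : Cx N k → N → Prop) [IsRec fun γ : Cx N (k + 1) => R γ.1 γ.2] :
    IsRec fun γ => ∃ x, R γ x := by
  have h := hS.out (fun z x => ∃ γ : Cx N k, z = code γ ∧ R γ x)
    (isRec_exists_code fun γ : Cx N (k + 1) => R γ.1 γ.2)
  have := isPoly_code (N := N) k
  refine IsRec.of_iff (S := fun γ => code γ ∈ {z : N | ∃ x, ∃ γ : Cx N k, z = code γ ∧ R γ x})
    inferInstance fun γ => ⟨fun ⟨x, hx⟩ => ⟨x, γ, rfl, hx⟩, fun ⟨x, δ, h, hx⟩ => ⟨x, ?_⟩⟩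
  rw [code_injective h]
  exact hx

instance IsRec.all (R : Cx N k → N → Prop) [IsRec fun γ : Cx N (k + 1) => R γ.1 γ.2] :
    IsRec fun γ => ∀ x, R γ x :=
  IsRec.of_iff (S := fun γ => ¬ ∃ x, ¬ R γ x) inferInstance fun γ => by push Not; rfl

theorem isRec_sat (φ : ArithFormula) {V : ℕ → Set N} (hV : ∀ i, V i ∈ L2Structure.sets)
    (w : ℕ → N) : IsRec fun γ : Cx N k => φ.Sat V (val γ w) := by
  have ht {k : ℕ} (t : NumTerm) : IsPoly fun γ : Cx N k => t.eval (val γ w) :=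
    ⟨t, w, fun _ => rfl⟩
  induction φ generalizing k with
  | eq s t =>
    have := ht (k := k) s
    have := ht (k := k) t
    exact IsRec.eq _ _
  | lt s t =>
    have := ht (k := k) s
    have := ht (k := k) t
    exact IsRec.lt _ _
  | mem t i =>
    have := ht (k := k) t
    have : IsSet (V i) := ⟨hV i⟩
    exact IsRec.mem _ _
  | neg φ ih =>
    have := ih (k := k)
    exact IsRec.not _
  | and φ ψ ih₁ ih₂ =>
    have := ih₁ (k := k)
    have := ih₂ (k := k)
    exact IsRec.and _ _
  | ball t φ ih =>
    have := ht (k := k) t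
    have : IsRec fun γ : Cx N (k + 1) => φ.Sat V (push γ.2 (val γ.1 w)) := ih
    exact IsRec.ball _ fun γ x => φ.Sat V (push x (val γ w))
  | all φ ih =>
    have : IsRec fun γ : Cx N (k + 1) => φ.Sat V (push γ.2 (val γ.1 w)) := ih
    exact IsRec.all fun γ x => φ.Sat V (push x (val γ w))

end

theorem SigmaComprehension.aca0 (h : SigmaComprehension N) : ACA0 N := by
  refine ⟨basic, fun X hX h0 hs n => ?_, fun φ v V hV => ?_⟩
  · have : IsSet X := ⟨hX⟩
    exact rec_induction (fun n => n ∈ X) h0 hs n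
  · have : Fact (SigmaComprehension N) := ⟨h⟩
    have : IsRec fun γ : Cx N 1 => φ.Sat V (push γ.2 v) := isRec_sat φ hV v
    exact (isSet_setOf fun n => φ.Sat V (push n v)).out

omit hN in
theorem ACA0.sigmaComprehension (h : ACA0 N) : SigmaComprehension N := by
  rintro R ⟨⟨θ, V, w, -, hV, hθ⟩⟩
  have := h.comprehension (.neg (.all (.neg θ))) w V hV
  refine ⟨?_⟩
  convert this using 3 with n
  rw [ArithFormula.Sat, ArithFormula.Sat, not_forall]
  exact exists_congr fun m => (hθ (((Cx.nil N).snoc n).snoc m)).trans not_not.symm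

/-! ### The greedy basis -/

/-- The greedy set `B` for a set `E` of pairs `pair n u`, in which `u` is the code enumerated at
`n`: a number `y ∈ M` belongs to `B` unless it completes, together with smaller elements of `B`, an
enumerated set. -/
theorem exists_greedy [Fact (SigmaComprehension N)] (M E : Set N) [IsSet M] [IsSet E] :
    ∃ B : Set N, IsSet B ∧ ∀ y, y ∈ B ↔ y ∈ M ∧
      ¬ ∃ n u, pair n u ∈ E ∧ ∀ i < u, i ∈ finSet u → i ∈ B ∧ i < y ∨ i = y := by
  let D (C : Set N) (y : N) : Prop :=
    ∃ n u, pair n u ∈ E ∧ ∀ i < u, i ∈ finSet u → i ∈ C ∧ i < y ∨ i = y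
  have hD {C C' : Set N} {y : N} (h : ∀ i < y, i ∈ C ↔ i ∈ C') : D C y ↔ D C' y := by
    refine exists_congr fun n => exists_congr fun u => and_congr_right fun _ =>
      forall_congr' fun i => imp_congr_right fun _ => imp_congr_right fun _ =>
      or_congr_left (and_congr_left fun hi => h i hi)
  -- The elements of `finSet c` below `a` are chosen according to the greedy rule.
  let G (a c : N) : Prop := ∀ y < a, y ∈ finSet c ↔ y ∈ M ∧ ¬ D (finSet c) y
  have hG : IsRec fun γ : Cx N 2 => G γ.1.2 γ.2 := by
    unfold G D; infer_instance
  have hGS : IsRec fun γ : Cx N 2 => G (γ.1.2 + 1) γ.2 :=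
    IsRec.comp₂ G (fun γ : Cx N 2 => γ.1.2 + 1) fun γ => γ.2
  have total : ∀ a, ∃ c, G a c := by
    refine exists_induction G ⟨0, fun y hy => absurd hy not_lt_zero⟩ fun a ⟨c, hc⟩ => ?_
    obtain ⟨d, hd⟩ := exists_finSet (a + 1)
      {i | i < a ∧ i ∈ finSet c ∨ i = a ∧ a ∈ M ∧ ¬ D (finSet c) a}
    have hlt {i : N} (hi : i < a) : i ∈ finSet d ↔ i ∈ finSet c := by
      simp [hd, hi, hi.ne, hi.trans (lt_add_one_iff'.2 le_rfl)]
    refine ⟨d, fun y hy => ?_⟩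
    obtain hy | rfl := (lt_add_one_iff'.1 hy).lt_or_eq
    · rw [hlt hy, hc y hy, hD fun i hi => hlt (hi.trans hy)]
    · rw [hD fun i hi => hlt hi, hd]
      simp
  have agree {a a' c c' : N} (h : G a c) (h' : G a' c') (y : N) :
      y < a → y < a' → (y ∈ finSet c ↔ y ∈ finSet c') := by
    refine strong_induction
      (X := {y | y < a → y < a' → (y ∈ finSet c ↔ y ∈ finSet c')}) (fun y ih hy hy' => ?_) y
    rw [h y hy, h' y hy', hD fun i hi => ih i hi (hi.trans hy) (hi.trans hy')]
  have hB : ∀ {a c y : N}, G a c → y < a →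
      ((∃ c, G (y + 1) c ∧ y ∈ finSet c) ↔ y ∈ finSet c) := by
    refine fun {a c y} h hy => ⟨fun ⟨c', h', hc'⟩ => ?_, fun hc => ?_⟩
    · exact (agree h' h y (lt_add_one_iff'.2 le_rfl) hy).1 hc'
    · obtain ⟨c', h'⟩ := total (y + 1)
      exact ⟨c', h', (agree h h' y hy (lt_add_one_iff'.2 le_rfl)).1 hc⟩
  refine ⟨{y | ∃ c, G (y + 1) c ∧ y ∈ finSet c}, inferInstance, fun y => ?_⟩
  obtain ⟨c, hc⟩ := total (y + 1)
  have hy : y < y + 1 := lt_add_one_iff'.2 le_rfl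
  refine (hB hc hy).trans ((hc y hy).trans (and_congr_right fun _ => not_congr ?_))
  exact hD fun i hi => (hB hc (hi.trans hy)).symm

theorem exists_isBasis [Fact (SigmaComprehension N)] {M : Set N} {e : N → N}
    (h : IsEMatroid M e) : ∃ B, IsBasis M e B := by
  have : IsSet M := ⟨h.ground⟩
  have : IsSet {z | ∃ n, z = pair n (e n)} := ⟨h.enum⟩
  obtain ⟨B, hB, hy⟩ := exists_greedy M {z | ∃ n, z = pair n (e n)}
  have hE {n u : N} : pair n u ∈ {z | ∃ n, z = pair n (e n)} ↔ u = e n := by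
    simp [pair_inj]
  simp only [hE, exists_eq_left] at hy
  refine ⟨B, hB.out, fun y hyB => ((hy y).1 hyB).1, fun n hn => ?_, fun x hx hxB => ?_⟩
  · have key : ∀ y, ¬ ∀ i < e n, i ∈ finSet (e n) → i ∈ B ∧ i < y := by
      refine rec_induction (fun y => ¬ ∀ i < e n, i ∈ finSet (e n) → i ∈ B ∧ i < y)
        (fun h0 => ?_) fun y ih hs => ?_
      · refine h.empty_indep n (Set.eq_empty_of_forall_notMem fun i hi => ?_)
        exact not_lt_zero (h0 i (lt_of_mem_finSet hi) hi).2
      · by_cases hyn : y ∈ finSet (e n)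
        · refine ((hy y).1 (hn hyn)).2 ⟨n, fun i hi hin => ?_⟩
          obtain ⟨hiB, hiy⟩ := hs i hi hin
          exact (lt_add_one_iff'.1 hiy).lt_or_eq.imp_left fun h => ⟨hiB, h⟩
        · refine ih fun i hi hin => ⟨hn hin, ?_⟩
          exact (lt_add_one_iff'.1 (hs i hi hin).2).lt_of_ne fun h => hyn (h ▸ hin)
    exact key (e n) fun i hi hin => ⟨hn hin, hi⟩
  · have : ∃ n, ∀ i < e n, i ∈ finSet (e n) → i ∈ B ∧ i < x ∨ i = x :=
      not_not.1 fun hd => hxB ((hy x).2 ⟨hx, hd⟩)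
    obtain ⟨n, hn⟩ := this
    exact ⟨n, fun i hi => (hn i (lt_of_mem_finSet hi) hi).imp_left And.left⟩

/-! ### The e-matroid of parallel pairs -/

theorem exists_code_pair (x : N) :
    ∃ u, IsFinCode u ∧ ∀ i, i ∈ finSet u ↔ i = pair x 0 ∨ i = pair x 1 := by
  obtain ⟨c, hc⟩ := exists_finSet (pair x 1 + 1) {i : N | i = pair x 0 ∨ i = pair x 1}
  obtain ⟨u, hu, huc⟩ := exists_isFinCode c
  refine ⟨u, hu, fun i => ?_⟩
  rw [huc, hc, lt_add_one_iff']
  refine and_iff_right_of_imp ?_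
  rintro (rfl | rfl)
  exacts [(pair_lt_of_add_lt (by simp)).le, le_rfl]

/-- An enumeration, inside the model, of the codes of all finite sets that include a pair
`{pair x 0, pair x 1}` with `x` in the nonempty `Σ⁰₁` class `∃ y, R x y`. The number
`pair y (pair x u)` enumerates `u` when `y` witnesses that `x` belongs to the class; all
other numbers enumerate a fixed set of this kind. -/
theorem exists_enumeration (R : N → N → Prop) [IsRec fun γ : Cx N 2 => R γ.1.2 γ.2]
    (hR : ∃ x y, R x y) : ∃ e : N → N, IsInternalFun e ∧ ∀ u, (∃ n, e n = u) ↔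
      IsFinCode u ∧ ∃ x, (∃ y, R x y) ∧ pair x 0 ∈ finSet u ∧ pair x 1 ∈ finSet u := by
  classical
  obtain ⟨x₀, y₀, h₀⟩ := hR
  obtain ⟨u₀, hu₀, hx⟩ := exists_code_pair x₀
  have hx₀ := (hx _).2 (Or.inl rfl)
  have hx₁ := (hx _).2 (Or.inr rfl)
  let P (n u : N) : Prop := ∃ y ≤ n, ∃ x ≤ n, n = pair y (pair x u) ∧
    R x y ∧ IsFinCode u ∧ pair x 0 ∈ finSet u ∧ pair x 1 ∈ finSet u
  have hR' : IsRec fun γ : Cx N 4 => R γ.2 γ.1.2 :=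
    IsRec.comp₂ R (fun γ : Cx N 4 => γ.2) fun γ => γ.1.2
  have hP : IsRec fun γ : Cx N 2 => P γ.1.2 γ.2 := inferInstance
  have hP' {k : ℕ} (f g : Cx N k → N) [IsPoly f] [IsPoly g] : IsRec fun γ => P (f γ) (g γ) :=
    IsRec.comp₂ P f g
  have huniq {n u v : N} (h : P n u) (h' : P n v) : u = v := by
    obtain ⟨y, -, x, -, rfl, -⟩ := h
    obtain ⟨y', -, x', -, h, -⟩ := h'
    exact (pair_inj.1 (pair_inj.1 h).2).2
  have hle {n u : N} (h : P n u) : u ≤ n := by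
    obtain ⟨y, -, x, -, rfl, -⟩ := h
    exact (le_pair_right _ _).trans (le_pair_right _ _)
  let e (n : N) : N := if h : ∃ u, P n u then h.choose else u₀
  have he {n u : N} : u = e n ↔ P n u ∨ (¬ ∃ v ≤ n, P n v) ∧ u = u₀ := by
    by_cases h : ∃ u, P n u
    · have h₁ : e n = h.choose := dif_pos h
      have h₂ : ∃ v ≤ n, P n v := ⟨_, hle h.choose_spec, h.choose_spec⟩
      simp only [h₁, h₂, not_true, false_and, or_false]
      exact ⟨fun h' => h' ▸ h.choose_spec, fun h' => huniq h' h.choose_spec⟩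
    · have h₁ : e n = u₀ := dif_neg h
      simp only [not_exists] at h
      simp [h₁, h]
  refine ⟨e, ?_, fun u => ⟨?_, ?_⟩⟩
  · have : IsSet {z : N | ∃ n ≤ z, ∃ u ≤ z, z = pair n u ∧
        (P n u ∨ (¬ ∃ v ≤ n, P n v) ∧ u = u₀)} := inferInstance
    unfold IsInternalFun
    convert this.out using 3 with z
    simp only [← he]
    constructor
    · rintro ⟨n, rfl⟩
      exact ⟨n, le_pair_left _ _, e n, le_pair_right _ _, rfl, rfl⟩
    · rintro ⟨n, -, u, -, h, rfl⟩
      exact ⟨n, h⟩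
  · rintro ⟨n, hn⟩
    obtain ⟨y, -, x, -, -, hR, hu, hx⟩ | ⟨-, rfl⟩ := he.1 hn.symm
    · exact ⟨hu, x, ⟨y, hR⟩, hx⟩
    · exact ⟨hu₀, x₀, ⟨y₀, h₀⟩, hx₀, hx₁⟩
  · rintro ⟨hu, x, ⟨y, hR⟩, hx⟩
    exact ⟨pair y (pair x u), (he.2 (Or.inl ⟨y, le_pair_left _ _, x,
      (le_pair_left _ _).trans (le_pair_right _ _), rfl, hR, hu, hx⟩)).symm⟩

/-- For some `x`, the numbers `i` and `j` are `pair x 0` and `pair x 1` in one of the two orders. -/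
def Partner (i j : N) : Prop :=
  ∃ x ≤ i, i = pair x 0 ∧ j = pair x 1 ∨ i = pair x 1 ∧ j = pair x 0

theorem Partner.left_unique {i i' j : N} (h : Partner i j) (h' : Partner i' j) : i = i' := by
  obtain ⟨x, -, ⟨rfl, rfl⟩ | ⟨rfl, rfl⟩⟩ := h <;>
    obtain ⟨x', -, ⟨rfl, h⟩ | ⟨rfl, h⟩⟩ := h' <;> simp_all [pair_inj]

theorem not_cardLT_of_partner {X Y : N}
    (h : ∀ j ∈ finSet Y, ∃ j' ∈ finSet X, Partner j j') : ¬ CardLT X Y := by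
  rintro ⟨a, b, ⟨p, hp, hp₁', hp₂⟩, ⟨q, hq, hq₁, hq₂⟩, hab⟩
  have hrec {k : ℕ} (f g : Cx N k → N) [IsPoly f] [IsPoly g] :
      IsRec fun γ => Partner (f γ) (g γ) := by
    have : IsRec fun γ : Cx N 2 => Partner γ.1.2 γ.2 := by unfold Partner; infer_instance
    exact IsRec.comp₂ Partner f g
  have mem {i k : N} : pair i k ∈ {z : N | ∃ i ≤ z, ∃ k ≤ z, z = pair i k ∧
      ∃ j < q, pair i j ∈ finSet q ∧ ∃ j' < p, pair k j' ∈ finSet p ∧ Partner j j'} ↔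
      ∃ j j', pair i j ∈ finSet q ∧ pair k j' ∈ finSet p ∧ Partner j j' := by
    constructor
    · rintro ⟨i', -, k', -, h, j, -, hj, j', -, hj', hjj⟩
      obtain ⟨rfl, rfl⟩ := pair_inj.1 h
      exact ⟨j, j', hj, hj', hjj⟩
    · rintro ⟨j, j', hj, hj', hjj⟩
      exact ⟨i, le_pair_left _ _, k, le_pair_right _ _, rfl,
        j, (le_pair_right _ _).trans_lt (lt_of_mem_finSet hj), hj,
        j', (le_pair_right _ _).trans_lt (lt_of_mem_finSet hj'), hj', hjj⟩
  refine hab.not_ge (le_of_injection (X := {z : N | ∃ i ≤ z, ∃ k ≤ z, z = pair i k ∧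
      ∃ j < q, pair i j ∈ finSet q ∧ ∃ j' < p, pair k j' ∈ finSet p ∧ Partner j j'})
      (fun i hi => ?_) fun i hi i' hi' k hk hik hik' => ?_)
  · obtain ⟨j, hj, -⟩ := hq₁ i hi
    have hjY : j ∈ finSet Y := by
      obtain ⟨i', j', h', -, hj'⟩ := hq _ hj
      rwa [(pair_inj.1 h').2]
    obtain ⟨j', hj', hjj⟩ := h j hjY
    obtain ⟨k, hk, -⟩ := hp₂ j' hj'
    refine ⟨k, ?_, mem.2 ⟨j, j', hj, hk, hjj⟩⟩
    obtain ⟨k', _, h', hk', -⟩ := hp _ hk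
    rwa [(pair_inj.1 h').1]
  · obtain ⟨j₁, j₁', h₁, h₁', hp₁⟩ := mem.1 hik
    obtain ⟨j₂, j₂', h₂, h₂', hp₂'⟩ := mem.1 hik'
    obtain rfl : j₁' = j₂' := (hp₁' k hk).unique h₁' h₂'
    obtain rfl := hp₁.left_unique hp₂'
    have hY : j₁ ∈ finSet Y := by
      obtain ⟨_, _, h', -, hj'⟩ := hq _ h₁
      rwa [(pair_inj.1 h').2]
    exact (hq₂ j₁ hY).unique h₁ h₂

/-- In the e-matroid in which `pair x 0` and `pair x 1` are parallel for the `x` of a `Σ⁰₁` class,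
a basis contains both of them exactly if `x` lies outside the class. -/
theorem sigmaComprehension_of_bases (h : EveryEMatroidHasBasis N) : SigmaComprehension N := by
  intro R hR
  by_cases hne : ∃ x y, R x y
  · obtain ⟨e, he, hmem⟩ := exists_enumeration R hne
    have enum {X : N} (hX : IsFinCode X) : (∃ n, finSet (e n) = finSet X) ↔
        ∃ x, (∃ y, R x y) ∧ pair x 0 ∈ finSet X ∧ pair x 1 ∈ finSet X := by
      constructor
      · rintro ⟨n, hn⟩
        rw [← hn]
        exact ((hmem _).1 ⟨n, rfl⟩).2
      · intro hx
        obtain ⟨n, hn⟩ := (hmem X).2 ⟨hX, hx⟩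
        exact ⟨n, by rw [hn]⟩
    have hdep (n : N) := ((hmem _).1 ⟨n, rfl⟩).2
    have hM : IsEMatroid Set.univ e := by
      refine ⟨?_, he, fun n => ⟨((hmem _).1 ⟨n, rfl⟩).1, Set.subset_univ _⟩, fun n hn => ?_,
        fun n Y hY hnY => ?_, fun X hX Y hY hlt hind => ?_⟩
      · have : IsSet {i : N | i = i} := inferInstance
        simpa using this.out
      · obtain ⟨x, -, hx, -⟩ := hdep n
        rw [hn] at hx
        exact hx
      · obtain ⟨x, hx, h0, h1⟩ := hdep n
        exact (enum hY.1).2 ⟨x, hx, hnY h0, hnY h1⟩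
      · by_contra! hno
        refine not_cardLT_of_partner (fun y hy => ?_) hlt
        obtain ⟨n, hn⟩ := hno y hy
        obtain ⟨x, hx, h0, h1⟩ := hdep n
        have hX' : ¬ (pair x 0 ∈ finSet X ∧ pair x 1 ∈ finSet X) := fun h => by
          obtain ⟨m, hm⟩ := (enum hX.1).2 ⟨x, hx, h⟩
          exact (hind m).1 hm
        rw [hn] at h0 h1
        obtain h0 | rfl := h0
        · obtain h1 | rfl := h1
          · exact absurd ⟨h0, h1⟩ hX'
          · exact ⟨_, h0, x, le_pair_left _ _, Or.inr ⟨rfl, rfl⟩⟩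
        · obtain h1 | h1 := h1
          · exact ⟨_, h1, x, le_pair_left _ _, Or.inl ⟨rfl, rfl⟩⟩
          · simp [pair_inj] at h1
    obtain ⟨B, hB, -, hind, hspan⟩ := h _ e hM
    have : IsSet B := ⟨hB⟩
    have hpair {x : N} (hx : ∃ y, R x y) : ¬ (pair x 0 ∈ B ∧ pair x 1 ∈ B) := by
      rintro ⟨h0, h1⟩
      obtain ⟨u, hu, hux⟩ := exists_code_pair x
      obtain ⟨n, rfl⟩ := (hmem u).2 ⟨hu, x, hx, (hux _).2 (Or.inl rfl), (hux _).2 (Or.inr rfl)⟩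
      refine hind n fun i hi => ?_
      obtain rfl | rfl := (hux i).1 hi
      exacts [h0, h1]
    have key : {n | ∃ m, R n m} = {n | ¬ (pair n 0 ∈ B ∧ pair n 1 ∈ B)} := by
      ext x
      refine ⟨hpair, fun hx => ?_⟩
      obtain ⟨z, hz, hzB⟩ : ∃ z, (z = pair x 0 ∨ z = pair x 1) ∧ z ∉ B := by
        by_contra! hall
        exact hx ⟨hall _ (Or.inl rfl), hall _ (Or.inr rfl)⟩
      obtain ⟨n, hn⟩ := hspan z (Set.mem_univ _) hzB
      obtain ⟨x', hx', h0, h1⟩ := hdep n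
      -- The dependent pair of `x'` is included in `B ∪ {z}` but not in `B`, so it contains `z`.
      suffices x = x' by rwa [this]
      by_contra hne
      have hB' {i : N} (hi : pair x' i ∈ finSet (e n)) : pair x' i ∈ B := by
        refine (hn hi).resolve_right fun h => hne ?_
        rw [Set.mem_singleton_iff] at h
        rw [← h, pair_inj, pair_inj] at hz
        exact hz.elim (fun h => h.1.symm) fun h => h.1.symm
      exact hpair hx' ⟨hB' h0, hB' h1⟩
    rw [key]
    infer_instance
  · have : {n | ∃ m, R n m} = {n : N | n ≠ n} := by
      ext x
      simpa using fun y hy => hne ⟨x, y, hy⟩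
    rw [this]
    infer_instance

end SOA

theorem theorem1 (N : Type*) [SOA.L2Structure N] (hN : SOA.RCA0 N) :
    SOA.ACA0 N ↔ SOA.EveryEMatroidHasBasis N := by
  have : Fact (SOA.RCA0 N) := ⟨hN⟩
  refine ⟨fun h M e hM => ?_, fun h => (SOA.sigmaComprehension_of_bases h).aca0⟩
  have : Fact (SOA.SigmaComprehension N) := ⟨h.sigmaComprehension⟩
  exact SOA.exists_isBasis hM
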